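/- Let $n\ge 1$ be an integer and write $[n]_q = 1+q+\cdots+q^{n-1}$. The $q$-deformed metallic number $\Phi_n(q)$, i.e. the $q$-deformation of $\frac{n+\sqrt{n^2+4}}{2}$ in the sense of Morier-Genoud and Ovsienko, is by definition the sum of the $2$-periodic continued fraction $$\Phi_n(q) = [n]_q + \cfrac{q^{n}}{[n]_{q^{-1}} + \cfrac{q^{-n}}{[n]_q + \cfrac{q^{n}}{[n]_{q^{-1}} + \cfrac{q^{-n}}{[n]_q+\ddots}}}}.$$ This continued fraction converges in the field $\mathbb{Q}((q))$ of formal Laurent series (with its $q$-adic topology) to a unique power series $\Phi_n(q)=\sum_{i\ge 0} f_i q^i$ with integer coefficients $f_i$. For $\ell, j\ge 0$ put $$\Delta^{(\ell)}_j := \det\bigl(f_{\ell+a+b}\bigr)_{0\le a,b\le j-1},\qquad \Delta^{(\ell)}_0 := 1 .$$ Then for every $\ell\in\{0,1,\ldots,n+1\}$ the sequence $(\Delta^{(\ell)}_j)_{j\ge 0}$ satisfies the three-term Gale–Robinson recurrence $$\Delta^{(\ell)}_{j+2n+2}\,\Delta^{(\ell)}_j = \Delta^{(\ell)}_{j+2n+1}\,\Delta^{(\ell)}_{j+1}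 - \bigl(\Delta^{(\ell)}_{j+n+1}\bigr)^2\qquad\text{for all } j\ge 0 .$$ -/

import Mathlib

open scoped PowerSeries LaurentSeries

/-- The `q`-integer `[n]_x = 1 + x + ⋯ + x ^ (n - 1)` in the parameter `x`. -/
def qInt {K : Type*} [Semiring K] (n : ℕ) (x : K) : K :=
  ∑ i ∈ Finset.range n, x ^ i

/-- The indeterminate `q` of the field `ℚ((q))` of formal Laurent series. -/
noncomputable def qVar : ℚ⸨X⸩ := HahnSeries.single 1 1

/-- The `2`-periodic continued fraction
`[n]_q + q^n / ([n]_{q⁻¹} + q^(-n) / ([n]_q + q^n / ([n]_{q⁻¹} + q^(-n) / ([n]_q + ⋯))))`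
over `ℚ((q))`, which defines the `q`-deformation of the metallic number
`(n + √(n ^ 2 + 4)) / 2`. -/
noncomputable def qMetallicContFract (n : ℕ) : GenContFract ℚ⸨X⸩ where
  h := qInt n qVar
  s := Stream'.Seq.ofStream fun k : ℕ =>
    if Even k then ⟨qVar ^ n, qInt n qVar⁻¹⟩ else ⟨(qVar ^ n)⁻¹, qInt n qVar⟩

/-- The power series `Φ` with integer coefficients is the `n`-th `q`-metallic number: in the field
`ℚ((q))` with its `q`-adic topology, the convergents of the defining continued fraction
converge to `Φ`. -/
def IsQMetallic (n : ℕ) (Φ : ℤ⟦X⟧) : Prop :=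
  Filter.Tendsto (qMetallicContFract n).convs Filter.atTop
    (nhds ((PowerSeries.map (Int.castRingHom ℚ) Φ : ℚ⟦X⟧) : ℚ⸨X⸩))

/-- The Hankel determinant `Δ_j^(ℓ)(F) = det (f_(ℓ + a + b))_{0 ≤ a, b < j}` of the power series
`F = ∑ f_i q^i`, with shift `ℓ` and size `j`; it is `1` for `j = 0`. -/
noncomputable def hankelDet {R : Type*} [CommRing R] (F : R⟦X⟧) (ℓ j : ℕ) : R :=
  Matrix.det (Matrix.of fun a b : Fin j => PowerSeries.coeff (ℓ + (a : ℕ) + (b : ℕ)) F)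

/-!
The recurrence is the Desnanot–Jacobi identity in disguise. For the Hankel determinants of a power
series it reads `Δ_{m+2}^(0) Δ_m^(2) = Δ_{m+1}^(0) Δ_{m+1}^(2) - (Δ_{m+1}^(1))²`
(`hankelDet_condensation`), and the `q`-metallic number satisfies the *shift relation*
`Δ_{j+n+1}^(ℓ) = ± (-1)^j Δ_j^(ℓ+1)` for `0 ≤ ℓ ≤ n`. Substituting it for `ℓ = 0, 1` turns the
Desnanot–Jacobi identity into the Gale–Robinson recurrence for `ℓ = 0` and `j ≥ 1`; the case `j = 0`
is direct, because `Δ_n^(1) = 0`. A further use of the shift relation carries the recurrence from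
`ℓ` to `ℓ + 1`, as all signs cancel.

The shift relation comes from a formula for the Hankel determinants of an inverse
(`hankelDet_inversion`): if `U * E = 1` and `U` has constant coefficient `1`, then
`Δ_{d+j}^(1)(X ^ d * E) = ± Δ_j^(d+1)(U)`. Indeed, conjugating the Hankel matrix of `X ^ d * E` by
the unitriangular Toeplitz matrix of `U` makes it block diagonal, with an anti-triangular block of
size `d` and minus the Hankel matrix of the shifted series `U`. The series `Φ` is the root of
`X Φ² + ((1 - X) (1 + X ^ n) - X [n]) Φ = 1`, and this equation gives
`Φ = [n] + X ^ (2 n) H` with `1 / H = (1 - X) (1 + X ^ n) + X Φ`. Three inversions, with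
`d = 1, n - 1 - ℓ, ℓ + 1`, lead from the `ℓ`-th shift of `Φ` to `1 - X + X Φ`, that is, to the
`(ℓ + 1)`-st shift of `Φ`; for `ℓ = n` a single inversion with `d = n + 1` does.

The root exists over `ℤ`: it is obtained from the Catalan series by a substitution. The continued
fraction converges to it because advancing by two convergents is the map
`u ↦ [n] + q ^ (2 n) u / (1 + q [n] u)`, a contraction of the ring of power series with fixed point
`Φ`.
-/

/-! ### Hankel determinants and inversion of power series -/

theorem hankelDet_congr {R : Type*} [CommRing R] {F G : R⟦X⟧} {s t : ℕ}
    (h : ∀ i, PowerSeries.coeff (s + i) F = PowerSeries.coeff (t + i) G) (j : ℕ) :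
    hankelDet F s j = hankelDet G t j := by
  unfold hankelDet
  congr 1
  ext a b
  simp only [Matrix.of_apply, add_assoc, h]

theorem hankelDet_zero {R : Type*} [CommRing R] (F : R⟦X⟧) (s : ℕ) : hankelDet F s 0 = 1 := by
  simp [hankelDet]

theorem det_antitriangular {R : Type*} [CommRing R] (u : ℕ → R) (hu : u 0 = 1) (d : ℕ) :
    (Matrix.of fun a b : Fin d =>
      if d ≤ (a : ℕ) + b + 1 then u (a + b + 1 - d) else 0).det = (-1) ^ d.choose 2 := by
  induction d with
  | zero => simp
  | succ d ih =>
    rw [Matrix.det_succ_row_zero, Finset.sum_eq_single (Fin.last d)]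
    · have : (Matrix.of fun a b : Fin (d + 1) =>
          if d + 1 ≤ (a : ℕ) + b + 1 then u (a + b + 1 - (d + 1)) else 0).submatrix Fin.succ
            (Fin.last d).succAbove = Matrix.of fun a b : Fin d =>
          if d ≤ (a : ℕ) + b + 1 then u (a + b + 1 - d) else 0 := by
        ext a b
        simp only [Matrix.submatrix_apply, Matrix.of_apply, Fin.succAbove_last, Fin.val_succ,
          Fin.val_castSucc]
        rw [show (a : ℕ) + 1 + b + 1 - (d + 1) = a + b + 1 - d by omega]
        exact if_congr (by omega) rfl rfl
      rw [this, ih, Nat.choose_succ_succ' d 1]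
      simp [hu, pow_add]
    · intro b _ hb
      have : (b : ℕ) < d := Fin.val_lt_last hb
      have h0 : ¬ d + 1 ≤ ((0 : Fin (d + 1)) : ℕ) + b + 1 := by simpa using this
      rw [Matrix.of_apply, if_neg h0]
      simp
    · simp

/-- The entries of the block diagonal matrix to which the Hankel matrix of `1 / u`, with `d` leading
zeros inserted, is congruent: an anti-triangular block of size `d` and a Hankel block, both formed
from the sequence `u`. -/
def inversionEntry {R : Type*} [CommRing R] (u : ℕ → R) (d a b : ℕ) : R :=
  if a < d ∧ b < d then (if d ≤ a + b + 1 then u (a + b + 1 - d) else 0)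
  else if d ≤ a ∧ d ≤ b then -u (a + b + 1 - d) else 0

theorem inversionEntry_succ_left {R : Type*} [CommRing R] (u : ℕ → R) (d a b : ℕ) :
    inversionEntry u d (a + 1) b = inversionEntry u d a (b + 1)
      + u (a + 1) * (if b + 1 = d then 1 else 0) - u (b + 1) * (if a + 1 = d then 1 else 0) := by
  unfold inversionEntry
  rw [show a + 1 + b + 1 - d = a + (b + 1) + 1 - d by omega,
    show a + 1 + b + 1 = a + (b + 1) + 1 by omega]
  by_cases ha : a + 1 = d
  · have ea : a + (b + 1) + 1 - d = b + 1 := by omega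
    by_cases hb : b + 1 = d
    · rw [if_neg (by omega), if_neg (by omega), if_neg (by omega), if_neg (by omega)]
      simp [hb, show a = b by omega]
    · rw [if_neg (show ¬(a + 1 < d ∧ b < d) by omega), if_neg hb, if_pos ha, ea,
        if_neg (show ¬(d ≤ a ∧ d ≤ b + 1) by omega)]
      by_cases hb' : b + 1 < d
      · rw [if_neg (by omega), if_pos (by omega), if_pos (by omega)]
        simp
      · rw [if_pos (by omega), if_neg (by omega)]
        simp
  · rw [if_neg ha]
    by_cases hb : b + 1 = d
    · have eb : a + (b + 1) + 1 - d = a + 1 := by omega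
      rw [if_neg (show ¬(a < d ∧ b + 1 < d) by omega), if_pos hb, eb,
        if_neg (show ¬(d ≤ a + 1 ∧ d ≤ b) by omega)]
      by_cases ha' : a + 1 < d
      · rw [if_pos (by omega), if_pos (by omega), if_neg (by omega)]
        simp
      · rw [if_neg (by omega), if_pos (by omega)]
        simp
    · rw [if_neg hb, if_congr (show a + 1 < d ∧ b < d ↔ a < d ∧ b + 1 < d by omega) rfl rfl,
        if_congr (show d ≤ a + 1 ∧ d ≤ b ↔ d ≤ a ∧ d ≤ b + 1 by omega) rfl rfl]
      simp

/-- The product of the Toeplitz matrix of `U`, the Hankel matrix of `F` and the transposed Toeplitz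
matrix, when `U * F = X ^ d`. Both sides have the same first column and the same differences along
antidiagonals. -/
theorem sum_toeplitz_hankel {R : Type*} [CommRing R] {U F : R⟦X⟧} {d : ℕ}
    (hU : PowerSeries.coeff 0 U = 1) (h : U * F = PowerSeries.X ^ d) (b a : ℕ) :
    ∑ i ∈ Finset.range (a + 1), ∑ k ∈ Finset.range (b + 1),
      PowerSeries.coeff (a - i) U * PowerSeries.coeff (1 + i + k) F * PowerSeries.coeff (b - k) U
      = inversionEntry (fun i => PowerSeries.coeff i U) d a b := by
  -- the coefficient of `X ^ (c + 1)` in `U * F = X ^ d`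
  have hc (c : ℕ) : ∑ i ∈ Finset.range (c + 1), PowerSeries.coeff (c - i) U *
      PowerSeries.coeff (1 + i) F = (if c + 1 = d then 1 else 0) -
        PowerSeries.coeff (c + 1) U * PowerSeries.coeff 0 F := by
    have := congrArg (PowerSeries.coeff (c + 1)) h
    rw [mul_comm U F, PowerSeries.coeff_mul, Finset.Nat.sum_antidiagonal_eq_sum_range_succ_mk,
      Finset.sum_range_succ', PowerSeries.coeff_X_pow] at this
    rw [← this]
    simp only [Nat.sub_zero, mul_comm (PowerSeries.coeff 0 F), add_sub_cancel_right]
    refine Finset.sum_congr rfl fun i _ => ?_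
    rw [mul_comm, Nat.add_sub_add_right, add_comm 1 i]
  induction b generalizing a with
  | zero =>
    have hd : PowerSeries.coeff 0 F = if d = 0 then 1 else 0 := by
      have := congrArg (PowerSeries.coeff 0) h
      rw [PowerSeries.coeff_X_pow, PowerSeries.coeff_mul] at this
      simpa [hU, eq_comm] using this
    have := hc a
    simp only [zero_add, Finset.range_one, Finset.sum_singleton, add_zero, Nat.sub_zero, hU,
      mul_one, this, hd, inversionEntry]
    rcases lt_trichotomy (a + 1) d with ha | ha | ha
    · rw [if_neg (by omega), if_neg (by omega), if_pos (by omega), if_neg (by omega)]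
      simp
    · rw [if_pos (by omega), if_neg (by omega), if_pos (by omega), if_pos (by omega)]
      simp [show a + 1 - d = 0 by omega, hU]
    · by_cases h0 : d = 0
      · subst h0
        simp
      · rw [if_neg (by omega), if_neg (by omega), if_neg (by omega), if_neg (by omega)]
        simp
  | succ b ih =>
    have key := inversionEntry_succ_left (fun i => PowerSeries.coeff i U) d a b
    rw [← ih] at key
    have e1 : ∑ i ∈ Finset.range (a + 1 + 1), ∑ k ∈ Finset.range (b + 1),
        PowerSeries.coeff (a + 1 - i) U * PowerSeries.coeff (1 + i + k) F *
          PowerSeries.coeff (b - k) U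
        = ∑ i ∈ Finset.range (a + 1), ∑ k ∈ Finset.range (b + 1),
          PowerSeries.coeff (a - i) U * PowerSeries.coeff (i + k + 2) F *
            PowerSeries.coeff (b - k) U
          + PowerSeries.coeff (a + 1) U * ((if b + 1 = d then 1 else 0) -
            PowerSeries.coeff (b + 1) U * PowerSeries.coeff 0 F) := by
      rw [Finset.sum_range_succ', ← hc b, Finset.mul_sum]
      congr 1
      · refine Finset.sum_congr rfl fun i _ => Finset.sum_congr rfl fun k _ => ?_
        rw [Nat.add_sub_add_right, show 1 + (i + 1) + k = i + k + 2 by omega]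
      · refine Finset.sum_congr rfl fun k _ => ?_
        simp only [Nat.sub_zero, add_zero]
        ring
    have e2 : ∑ i ∈ Finset.range (a + 1), ∑ k ∈ Finset.range (b + 1 + 1),
        PowerSeries.coeff (a - i) U * PowerSeries.coeff (1 + i + k) F *
          PowerSeries.coeff (b + 1 - k) U
        = ∑ i ∈ Finset.range (a + 1), ∑ k ∈ Finset.range (b + 1),
          PowerSeries.coeff (a - i) U * PowerSeries.coeff (i + k + 2) F *
            PowerSeries.coeff (b - k) U
          + PowerSeries.coeff (b + 1) U * ((if a + 1 = d then 1 else 0) -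
            PowerSeries.coeff (a + 1) U * PowerSeries.coeff 0 F) := by
      rw [← hc a, Finset.mul_sum, ← Finset.sum_add_distrib]
      refine Finset.sum_congr rfl fun i _ => ?_
      rw [Finset.sum_range_succ']
      congr 1
      · refine Finset.sum_congr rfl fun k _ => ?_
        rw [Nat.add_sub_add_right, show 1 + i + (k + 1) = i + k + 2 by omega]
      · simp only [Nat.sub_zero, add_zero]
        ring
    rw [e1] at key
    rw [e2]
    linear_combination key

/-- **Inversion formula** for Hankel determinants: one step of a continued fraction with a partial
quotient of degree `d`. -/
theorem hankelDet_inversion {R : Type*} [CommRing R] {U E : R⟦X⟧} (h : U * E = 1)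
    (hU : PowerSeries.coeff 0 U = 1) (d j : ℕ) :
    hankelDet (PowerSeries.X ^ d * E) 1 (d + j)
      = (-1) ^ d.choose 2 * (-1) ^ j * hankelDet U (d + 1) j := by
  set F := PowerSeries.X ^ d * E with hF
  have hUF : U * F = PowerSeries.X ^ d := by rw [hF, mul_left_comm, h, mul_one]
  let T : Matrix (Fin (d + j)) (Fin (d + j)) R :=
    Matrix.of fun a i => if (i : ℕ) ≤ a then PowerSeries.coeff ((a : ℕ) - i) U else 0
  have hT : T.det = 1 := by
    rw [Matrix.det_of_isLowerTriangular]
    · simp [T, hU]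
    · intro a i hai
      simp only [T, Matrix.of_apply]
      rw [if_neg]
      simpa using hai
  let H : Matrix (Fin (d + j)) (Fin (d + j)) R :=
    Matrix.of fun a b => PowerSeries.coeff (1 + (a : ℕ) + (b : ℕ)) F
  have hsum (a : Fin (d + j)) (g : ℕ → R) :
      ∑ i : Fin (d + j), (if (i : ℕ) ≤ a then g i else 0) = ∑ i ∈ Finset.range (a + 1), g i := by
    rw [Fin.sum_univ_eq_sum_range (fun i => if i ≤ (a : ℕ) then g i else 0) (d + j),
      ← Finset.sum_filter]
    congr 1
    ext i
    simp only [Finset.mem_filter, Finset.mem_range]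
    omega
  have hmul : T * H * T.transpose
      = Matrix.of fun a b : Fin (d + j) =>
        inversionEntry (fun i => PowerSeries.coeff i U) d a b := by
    ext a b
    rw [Matrix.of_apply, ← sum_toeplitz_hankel hU hUF, Finset.sum_comm,
      ← hsum b fun k => ∑ i ∈ Finset.range ((a : ℕ) + 1), PowerSeries.coeff ((a : ℕ) - i) U *
        PowerSeries.coeff (1 + i + k) F * PowerSeries.coeff ((b : ℕ) - k) U, Matrix.mul_apply]
    refine Finset.sum_congr rfl fun k _ => ?_
    rw [Matrix.mul_apply, Matrix.transpose_apply]
    simp only [T, H, Matrix.of_apply, mul_ite, mul_zero]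
    refine if_congr Iff.rfl ?_ rfl
    rw [← Finset.sum_mul, ← hsum a fun i => PowerSeries.coeff ((a : ℕ) - i) U *
        PowerSeries.coeff (1 + i + (k : ℕ)) F]
    congr 1
    refine Finset.sum_congr rfl fun i _ => ?_
    rw [ite_mul, zero_mul]
  have hblock : (Matrix.of fun a b : Fin (d + j) =>
        inversionEntry (fun i => PowerSeries.coeff i U) d a b).submatrix
          finSumFinEquiv finSumFinEquiv
      = Matrix.fromBlocks
          (Matrix.of fun a b : Fin d => if d ≤ (a : ℕ) + b + 1 then
            PowerSeries.coeff (a + b + 1 - d) U else 0) 0 0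
          (-Matrix.of fun a b : Fin j => PowerSeries.coeff (d + 1 + (a : ℕ) + (b : ℕ)) U) := by
    ext (a | a) (b | b)
    · simp [inversionEntry]
    · simp [inversionEntry]
    · simp [inversionEntry]
    · simp [inversionEntry, show d + (a : ℕ) + (d + (b : ℕ)) + 1 - d = d + 1 + a + b by omega]
  have hdet : H.det = (T * H * T.transpose).det := by
    rw [Matrix.det_mul, Matrix.det_mul, Matrix.det_transpose, hT]
    ring
  change H.det = _
  rw [hdet, hmul, ← Matrix.det_submatrix_equiv_self finSumFinEquiv, hblock,
    Matrix.det_fromBlocks_zero₂₁, det_antitriangular (fun i => PowerSeries.coeff i U) hU,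
    Matrix.det_neg, Fintype.card_fin, mul_assoc]
  rfl

/-! ### The Desnanot–Jacobi identity -/

theorem det_mul_det_submatrix_inl_of_ne_zero {ι K : Type*} [Fintype ι] [DecidableEq ι] [Field K]
    (M : Matrix (ι ⊕ Fin 2) (ι ⊕ Fin 2) K) (h : (M.submatrix Sum.inl Sum.inl).det ≠ 0) :
    let minor (r s : Fin 2) := (M.submatrix (Sum.map id fun _ : Unit => r)
      (Sum.map id fun _ : Unit => s)).det
    M.det * (M.submatrix Sum.inl Sum.inl).det = minor 0 0 * minor 1 1 - minor 0 1 * minor 1 0 := by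
  intro minor
  obtain ⟨A, B, C, D, rfl⟩ : ∃ A B C D, M = Matrix.fromBlocks A B C D :=
    ⟨_, _, _, _, (Matrix.fromBlocks_toBlocks M).symm⟩
  have hA : (Matrix.fromBlocks A B C D).submatrix Sum.inl Sum.inl = A := rfl
  rw [hA] at h ⊢
  have : Invertible A := Matrix.invertibleOfIsUnitDet A (isUnit_iff_ne_zero.mpr h)
  have hminor (r s : Fin 2) : minor r s = A.det * (D - C * ⅟A * B) r s := by
    have : (Matrix.fromBlocks A B C D).submatrix (Sum.map id fun _ : Unit => r)
        (Sum.map id fun _ : Unit => s) = Matrix.fromBlocks A (Matrix.of fun i _ => B i s)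
          (Matrix.of fun _ i => C r i) (Matrix.of fun _ _ => D r s) := by
      ext (i | i) (k | k) <;> rfl
    rw [show minor r s = _ from congrArg Matrix.det this, Matrix.det_fromBlocks₁₁,
      Matrix.det_unique (n := Unit)]
    rfl
  rw [Matrix.det_fromBlocks₁₁, hminor, hminor, hminor, hminor, Matrix.det_fin_two]
  ring

/-- The **Desnanot–Jacobi identity**. It reduces to an invertible central block `A` on replacing `A`
by `A + X • 1` over the polynomial ring. -/
theorem det_mul_det_submatrix_inl {ι R : Type*} [Fintype ι] [DecidableEq ι] [CommRing R]
    [IsDomain R] (M : Matrix (ι ⊕ Fin 2) (ι ⊕ Fin 2) R) :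
    let minor (r s : Fin 2) := (M.submatrix (Sum.map id fun _ : Unit => r)
      (Sum.map id fun _ : Unit => s)).det
    M.det * (M.submatrix Sum.inl Sum.inl).det = minor 0 0 * minor 1 1 - minor 0 1 * minor 1 0 := by
  intro minor
  let M' : Matrix (ι ⊕ Fin 2) (ι ⊕ Fin 2) (Polynomial R) :=
    Matrix.fromBlocks (-M.toBlocks₁₁).charmatrix (M.toBlocks₁₂.map Polynomial.C)
      (M.toBlocks₂₁.map Polynomial.C) (M.toBlocks₂₂.map Polynomial.C)
  have hM' : M'.map (Polynomial.evalRingHom (0 : R)) = M := by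
    ext (i | i) (k | k)
    · by_cases hik : i = k
      · subst hik
        simp [M', Matrix.charmatrix_apply_eq, Matrix.toBlocks₁₁]
      · simp [M', Matrix.charmatrix_apply_ne _ _ _ hik, Matrix.toBlocks₁₁]
    · simp [M', Matrix.toBlocks₁₂]
    · simp [M', Matrix.toBlocks₂₁]
    · simp [M', Matrix.toBlocks₂₂]
  let φ := algebraMap (Polynomial R) (FractionRing (Polynomial R))
  have hφ : Function.Injective φ := IsFractionRing.injective _ _
  have hpoly := det_mul_det_submatrix_inl_of_ne_zero (M'.map φ) (by
    rw [Matrix.submatrix_map, ← RingHom.mapMatrix_apply, ← RingHom.map_det,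
      map_ne_zero_iff φ hφ]
    exact (Matrix.charpoly_monic (-M.toBlocks₁₁)).ne_zero)
  simp only [Matrix.submatrix_map] at hpoly
  simp only [← RingHom.mapMatrix_apply, ← RingHom.map_det, ← map_mul, ← map_sub] at hpoly
  have := congrArg (Polynomial.evalRingHom (0 : R)) (hφ hpoly)
  simp only [map_mul, map_sub, RingHom.map_det, RingHom.mapMatrix_apply] at this
  simpa only [← Matrix.submatrix_map, hM'] using this

theorem hankelDet_condensation {R : Type*} [CommRing R] [IsDomain R] (F : R⟦X⟧) (s m : ℕ) :
    hankelDet F s (m + 2) * hankelDet F (s + 2) m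
      = hankelDet F s (m + 1) * hankelDet F (s + 2) (m + 1) - hankelDet F (s + 1) (m + 1) ^ 2 := by
  let H (t j : ℕ) : Matrix (Fin j) (Fin j) R :=
    Matrix.of fun a b => PowerSeries.coeff (t + (a : ℕ) + (b : ℕ)) F
  have hHdet (t j : ℕ) : hankelDet F t j = (H t j).det := rfl
  -- the central indices, followed by the first and the last one
  let f : Fin m ⊕ Fin 2 → Fin (m + 2) := Sum.elim (fun i => i.succ.castSucc) ![0, Fin.last _]
  have hf : Function.Bijective f := by
    rw [Fintype.bijective_iff_injective_and_card]
    refine ⟨?_, by simp⟩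
    rintro (a | a) (b | b) hab <;> have hab := congrArg Fin.val hab
    · simpa [f, Fin.ext_iff] using hab
    · fin_cases b
      · simp [f] at hab
      · have := a.2
        simp [f] at hab
        omega
    · fin_cases a
      · simp [f] at hab
      · have := b.2
        simp [f] at hab
        omega
    · fin_cases a <;> fin_cases b <;> simp [f] at hab ⊢
  let e : Fin m ⊕ Fin 2 ≃ Fin (m + 2) := Equiv.ofBijective f hf
  -- the two ways of adjoining an index to the central ones: before them or after them
  let e₀ : Fin m ⊕ Unit ≃ Fin (m + 1) :=
    ((finSuccEquiv' 0).trans (Equiv.optionEquivSumPUnit _)).symm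
  let e₁ : Fin m ⊕ Unit ≃ Fin (m + 1) :=
    ((finSuccEquiv' (Fin.last m)).trans (Equiv.optionEquivSumPUnit _)).symm
  have he₀ (i : Fin m ⊕ Unit) : (e (Sum.map id (fun _ => 0) i) : ℕ) = e₀ i := by
    rcases i with i | i <;> simp [e, e₀, f]
  have he₁ (i : Fin m ⊕ Unit) : (e (Sum.map id (fun _ => 1) i) : ℕ) = e₁ i + 1 := by
    rcases i with i | i <;> simp [e, e₁, f]
  have key := det_mul_det_submatrix_inl ((H s (m + 2)).submatrix e e)
  have h00 : (((H s (m + 2)).submatrix e e).submatrix (Sum.map id fun _ : Unit => 0)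
      (Sum.map id fun _ : Unit => 0)) = (H s (m + 1)).submatrix e₀ e₀ := by
    ext i k
    simp only [H, Matrix.submatrix_apply, Matrix.of_apply, he₀]
  have h11 : (((H s (m + 2)).submatrix e e).submatrix (Sum.map id fun _ : Unit => 1)
      (Sum.map id fun _ : Unit => 1)) = (H (s + 2) (m + 1)).submatrix e₁ e₁ := by
    ext i k
    simp only [H, Matrix.submatrix_apply, Matrix.of_apply, he₁]
    congr 2
    omega
  have h01 : (((H s (m + 2)).submatrix e e).submatrix (Sum.map id fun _ : Unit => 0)
      (Sum.map id fun _ : Unit => 1)) = (H (s + 1) (m + 1)).submatrix e₀ e₁ := by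
    ext i k
    simp only [H, Matrix.submatrix_apply, Matrix.of_apply, he₀, he₁]
    congr 2
    omega
  have h10 : (((H s (m + 2)).submatrix e e).submatrix (Sum.map id fun _ : Unit => 1)
      (Sum.map id fun _ : Unit => 0)) = ((H (s + 1) (m + 1)).submatrix e₀ e₁).transpose := by
    ext i k
    simp only [H, Matrix.submatrix_apply, Matrix.of_apply, he₀, he₁, Matrix.transpose_apply]
    congr 2
    omega
  have hin : ((H s (m + 2)).submatrix e e).submatrix Sum.inl Sum.inl = H (s + 2) m := by
    ext i k
    simp only [H, Matrix.submatrix_apply, Matrix.of_apply, e, f, Equiv.ofBijective_apply,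
      Sum.elim_inl, Fin.val_castSucc, Fin.val_succ]
    congr 2
    omega
  -- `e₀` and `e₁` differ by a permutation, whose sign disappears on squaring
  have hsq : ((H (s + 1) (m + 1)).submatrix e₀ e₁).det ^ 2 = (H (s + 1) (m + 1)).det ^ 2 := by
    have : (H (s + 1) (m + 1)).submatrix e₀ e₁
        = ((H (s + 1) (m + 1)).submatrix e₀ e₀).submatrix id (e₁.trans e₀.symm) := by
      ext i k
      simp
    rw [this, Matrix.det_permute', Matrix.det_submatrix_equiv_self, mul_pow, ← Int.cast_pow,
      ← Units.val_pow_eq_pow_val, Int.units_sq]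
    simp
  simp only [h00, h11, h01, h10, hin, Matrix.det_submatrix_equiv_self, Matrix.det_transpose] at key
  rw [hHdet, hHdet, hHdet, hHdet, hHdet, key, ← hsq]
  ring

/-! ### The shift relation and the Gale–Robinson recurrence -/

theorem neg_one_pow_sq (R : Type*) [CommRing R] (k : ℕ) : ((-1 : R) ^ k) ^ 2 = 1 := by
  rw [← pow_mul, mul_comm, pow_mul, neg_one_sq, one_pow]

theorem one_sub_mul_qInt {R : Type*} [CommRing R] (n : ℕ) (x : R) :
    (1 - x) * qInt n x = 1 - x ^ n :=
  mul_neg_geom_sum x n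

theorem qInt_add {R : Type*} [CommRing R] (m n : ℕ) (x : R) :
    qInt (m + n) x = qInt m x + x ^ m * qInt n x := by
  simp only [qInt, Finset.sum_range_add, Finset.mul_sum, pow_add]

theorem coeff_qInt_X {R : Type*} [CommRing R] (n i : ℕ) :
    PowerSeries.coeff i (qInt n (PowerSeries.X : R⟦X⟧)) = if i < n then 1 else 0 := by
  simp [qInt, PowerSeries.coeff_X_pow, Finset.sum_ite_eq]

/-- The quadratic equation of the `q`-metallic number. It is the fixed point equation of one period
of the continued fraction, divided by `[n]`. -/
def IsMetallicRoot {R : Type*} [CommRing R] (n : ℕ) (Φ : R⟦X⟧) : Prop :=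
  PowerSeries.X * Φ ^ 2 + ((1 - PowerSeries.X) * (1 + PowerSeries.X ^ n)
    - PowerSeries.X * qInt n PowerSeries.X) * Φ = 1

theorem exists_mul_eq_one {R : Type*} [CommRing R] (U : R⟦X⟧) (h : PowerSeries.coeff 0 U = 1) :
    ∃ E : R⟦X⟧, U * E = 1 :=
  ⟨_, PowerSeries.mul_invOfUnit U 1 (by simpa using h)⟩

namespace IsMetallicRoot

variable {R : Type*} [CommRing R] {n : ℕ} {Φ : R⟦X⟧}

/-- The tail `H` of the expansion `Φ = [n] + q ^ (2 * n) * H`. -/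
theorem exists_tail (hn : 1 ≤ n) (h : IsMetallicRoot n Φ) : ∃ H : R⟦X⟧,
    ((1 - PowerSeries.X) * (1 + PowerSeries.X ^ n) + PowerSeries.X * Φ) * H = 1 ∧
    Φ = qInt n PowerSeries.X + PowerSeries.X ^ (2 * n) * H := by
  obtain ⟨H, hH⟩ := exists_mul_eq_one
    ((1 - PowerSeries.X) * (1 + PowerSeries.X ^ n) + PowerSeries.X * Φ)
    (by simp [show n ≠ 0 by omega])
  refine ⟨H, hH, ?_⟩
  have hN := one_sub_mul_qInt n (PowerSeries.X : R⟦X⟧)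
  unfold IsMetallicRoot at h
  set N := qInt n (PowerSeries.X : R⟦X⟧)
  have hV : (Φ - N) * ((1 - PowerSeries.X) * (1 + PowerSeries.X ^ n) + PowerSeries.X * Φ)
      = PowerSeries.X ^ (2 * n) := by
    linear_combination h - (1 + PowerSeries.X ^ n) * hN
  linear_combination H * hV - (Φ - N) * hH

theorem coeff_eq (hn : 1 ≤ n) (h : IsMetallicRoot n Φ) {i : ℕ} (hi : i < 2 * n) :
    PowerSeries.coeff i Φ = if i < n then 1 else 0 := by
  obtain ⟨H, -, hΦ⟩ := h.exists_tail hn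
  rw [hΦ, map_add, coeff_qInt_X, PowerSeries.coeff_X_pow_mul', if_neg (not_le.mpr hi), add_zero]

/-- The shift relation at the last shift `n`, where one inversion suffices. -/
theorem hankelDet_shift_last (hn : 1 ≤ n) (h : IsMetallicRoot n Φ) (j : ℕ) :
    hankelDet Φ n (j + n + 1)
      = (-1) ^ (n + 1).choose 2 * (-1) ^ j * hankelDet Φ (n + 1) j := by
  obtain ⟨H, hH, hΦ⟩ := h.exists_tail hn
  have key := hankelDet_inversion hH (by simp [show n ≠ 0 by omega]) (n + 1) j
  rw [show j + n + 1 = n + 1 + j by omega]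
  convert key using 1
  · refine hankelDet_congr (fun i => ?_) _
    rw [hΦ, map_add, coeff_qInt_X, if_neg (by omega), zero_add, PowerSeries.coeff_X_pow_mul',
      PowerSeries.coeff_X_pow_mul', show n + i - 2 * n = 1 + i - (n + 1) by omega]
    exact if_congr (by omega) rfl rfl
  · congr 1
    refine hankelDet_congr (fun i => ?_) _
    rw [show (1 - PowerSeries.X) * (1 + PowerSeries.X ^ n) + PowerSeries.X * Φ
        = 1 - PowerSeries.X + PowerSeries.X ^ n - PowerSeries.X ^ (n + 1)
          + PowerSeries.X * Φ by ring, show n + 1 + 1 + i = n + 1 + i + 1 by omega]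
    simp only [map_add, map_sub, PowerSeries.coeff_succ_X_mul, PowerSeries.coeff_X_pow,
      PowerSeries.coeff_one, PowerSeries.coeff_X]
    simp [show ¬ n + 1 + i + 1 = n by omega, show ¬ n + 1 + i = n by omega]

/-- The shift relation at a shift `s < n`, with `r = n - 1 - s`: three inversions lead from the
`s`-th shift of `Φ` to its `(s + 1)`-st shift. -/
theorem hankelDet_shift {s r : ℕ} (h : IsMetallicRoot (s + r + 1) Φ) (j : ℕ) :
    hankelDet Φ s (j + (s + r + 1) + 1)
      = (-1) ^ (r + r.choose 2 + (s + 1).choose 2) * (-1) ^ j * hankelDet Φ (s + 1) j := by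
  obtain ⟨H, hH, hΦ⟩ := h.exists_tail (by omega)
  set x : R⟦X⟧ := PowerSeries.X with hx
  have hN := one_sub_mul_qInt (r + 1) x
  set N := qInt (r + 1) x with hNdef
  obtain ⟨W, hW⟩ := exists_mul_eq_one (1 - x ^ (r + 1) + x ^ (s + r + 1 + (r + 1)) * (1 - x) * H)
    (by simp [hx])
  obtain ⟨Y, hY⟩ := exists_mul_eq_one (1 - x ^ (s + r + 1) * (1 - x) * H) (by simp [hx])
  have hWeq : W = 1 + x ^ (r + 1) * W * (1 - x ^ (s + r + 1) * (1 - x) * H) := by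
    linear_combination hW
  -- the successive complete quotients and their inverses
  set F := N + x ^ (s + r + 1 + (r + 1)) * H with hF
  set E := (1 - x) * (1 - x ^ (s + r + 1) * (1 - x) * H) * W with hE
  have h1 : ((1 - x) * W) * F = 1 := by
    rw [hF]
    linear_combination W * hN + hW
  have h2 : (N + x ^ (s + r + 1) * H * Y) * E = 1 := by
    rw [hE]
    linear_combination W * (1 - x ^ (s + r + 1) * (1 - x) * H) * hN + hW
      + (x ^ (s + r + 1) * H * (1 - x) * W) * hY
  have h3 : (1 - x + x * Φ) * (H * Y) = 1 := by
    linear_combination Y * hH + hY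
  have k1 := hankelDet_inversion h1 (by rw [hWeq]; simp [hx]) 1 (j + s + r + 1)
  have k2 := hankelDet_inversion h2 (by rw [map_add, hNdef, coeff_qInt_X]; simp [hx]) r (j + s + 1)
  have k3 := hankelDet_inversion h3 (by simp [hx]) (s + 1) j
  have c1 (i : ℕ) : PowerSeries.coeff (s + i) Φ = PowerSeries.coeff (1 + i) (x ^ 1 * F) := by
    rw [pow_one, add_comm 1 i, hx, PowerSeries.coeff_succ_X_mul, hΦ,
      show s + r + 1 = s + (r + 1) by omega, qInt_add, ← hNdef,
      show qInt s x + x ^ s * N + x ^ (2 * (s + (r + 1))) * H = qInt s x + x ^ s * F by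
        rw [hF]; ring, map_add, hx, coeff_qInt_X, if_neg (by omega), zero_add,
      PowerSeries.coeff_X_pow_mul', if_pos (by omega), Nat.add_sub_cancel_left]
  have c2 (i : ℕ) : PowerSeries.coeff (1 + 1 + i) ((1 - x) * W)
      = PowerSeries.coeff (1 + i) (x ^ r * E) := by
    rw [show (1 - x) * W = 1 - x + x * (x ^ r * E) by
      rw [hE]; linear_combination (1 - x) * hWeq, show 1 + 1 + i = 1 + i + 1 by omega, hx]
    simp [PowerSeries.coeff_succ_X_mul, PowerSeries.coeff_one, PowerSeries.coeff_X]
  have c3 (i : ℕ) : PowerSeries.coeff (r + 1 + i) (N + x ^ (s + r + 1) * H * Y)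
      = PowerSeries.coeff (1 + i) (x ^ (s + 1) * (H * Y)) := by
    rw [map_add, hNdef, hx, coeff_qInt_X, if_neg (by omega), zero_add, mul_assoc,
      PowerSeries.coeff_X_pow_mul', PowerSeries.coeff_X_pow_mul',
      show r + 1 + i - (s + r + 1) = 1 + i - (s + 1) by omega]
    exact if_congr (by omega) rfl rfl
  have c4 (i : ℕ) : PowerSeries.coeff (s + 1 + 1 + i) (1 - x + x * Φ)
      = PowerSeries.coeff (s + 1 + i) Φ := by
    rw [show s + 1 + 1 + i = s + 1 + i + 1 by omega, hx]
    simp [PowerSeries.coeff_succ_X_mul, PowerSeries.coeff_one, PowerSeries.coeff_X]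
  rw [hankelDet_congr c1, show j + (s + r + 1) + 1 = 1 + (j + s + r + 1) by omega, k1,
    hankelDet_congr c2, show j + s + r + 1 = r + (j + s + 1) by omega, k2, hankelDet_congr c3,
    show j + s + 1 = s + 1 + j by omega, k3, hankelDet_congr c4]
  have hsq := neg_one_pow_sq R (s + 1 + j)
  simp only [pow_add _ r, pow_add _ (r + _)]
  simp only [Nat.choose_succ_self, pow_zero, one_mul]
  linear_combination (-1 : R) ^ r * (-1) ^ r.choose 2 * (-1) ^ (s + 1).choose 2 * (-1) ^ j
    * hankelDet Φ (s + 1) j * hsq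

theorem exists_sign_hankelDet_shift (h : IsMetallicRoot n Φ) (hn : 1 ≤ n) {s : ℕ} (hs : s ≤ n) :
    ∃ ε : R, ε ^ 2 = 1 ∧
      ∀ j, hankelDet Φ s (j + n + 1) = ε * (-1) ^ j * hankelDet Φ (s + 1) j := by
  rcases hs.lt_or_eq with hs | rfl
  · obtain ⟨r, rfl⟩ : ∃ r, n = s + r + 1 := ⟨n - s - 1, by omega⟩
    exact ⟨_, neg_one_pow_sq R _, h.hankelDet_shift⟩
  · exact ⟨_, neg_one_pow_sq R _, h.hankelDet_shift_last hn⟩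

/-- The first two shift relations combined, with the sign made explicit. -/
theorem hankelDet_shift_two (h : IsMetallicRoot n Φ) (hn : 1 ≤ n) (j : ℕ) :
    hankelDet Φ 0 (j + 2 * n + 2) = -hankelDet Φ 2 j := by
  rw [show j + 2 * n + 2 = (j + n + 1) + n + 1 by omega]
  obtain rfl | ⟨m, rfl⟩ : n = 1 ∨ ∃ m, n = m + 2 := by
    rcases n with _ | _ | m
    · omega
    · exact Or.inl rfl
    · exact Or.inr ⟨m, rfl⟩
  · have h1 := hankelDet_shift (s := 0) (r := 0) h (j + 1 + 1)
    have h2 := h.hankelDet_shift_last hn j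
    norm_num at h1 h2 ⊢
    rw [h1, h2]
    linear_combination -hankelDet Φ 2 j * neg_one_pow_sq R j
  · have h1 := hankelDet_shift (s := 0) (r := m + 1) (by simpa using h) (j + (m + 2) + 1)
    have h2 := hankelDet_shift (s := 1) (r := m) (by rwa [show 1 + m + 1 = m + 2 by omega]) j
    rw [show 0 + (m + 1) + 1 = m + 2 by omega] at h1
    rw [show 1 + m + 1 = m + 2 by omega] at h2
    rw [h1, zero_add, h2, ← mul_assoc, ← pow_add, ← mul_assoc, ← pow_add, ← pow_add,
      Nat.choose_succ_succ' m 1, Nat.choose_one_right, Nat.choose_succ_self,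
      show Nat.choose (1 + 1) 2 = 1 by decide,
      Odd.neg_one_pow ⟨2 * m + m.choose 2 + j + 2, by ring⟩, neg_one_mul]

/-- The matrix of this determinant has a zero last row. -/
theorem hankelDet_one_eq_zero (h : IsMetallicRoot n Φ) (hn : 1 ≤ n) : hankelDet Φ 1 n = 0 := by
  refine Matrix.det_eq_zero_of_row_eq_zero ⟨n - 1, by omega⟩ fun b => ?_
  have := b.2
  rw [Matrix.of_apply, h.coeff_eq hn (by simp only; omega), if_neg (by simp only; omega)]

/-- The Gale–Robinson recurrence at shift `0`: the Desnanot–Jacobi identity with the determinants of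
shifts `1` and `2` expressed through those of shift `0`. -/
theorem hankelDet_recurrence_zero [IsDomain R] (h : IsMetallicRoot n Φ) (hn : 1 ≤ n) (j : ℕ) :
    hankelDet Φ 0 (j + 2 * n + 2) * hankelDet Φ 0 j =
      hankelDet Φ 0 (j + 2 * n + 1) * hankelDet Φ 0 (j + 1) - hankelDet Φ 0 (j + n + 1) ^ 2 := by
  obtain ⟨ε, hε, hshift⟩ := h.exists_sign_hankelDet_shift hn (Nat.zero_le n)
  have hsquare : hankelDet Φ 0 (j + n + 1) ^ 2 = hankelDet Φ 1 j ^ 2 := by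
    rw [hshift, zero_add]
    linear_combination ((-1) ^ j) ^ 2 * hankelDet Φ 1 j ^ 2 * hε
      + hankelDet Φ 1 j ^ 2 * neg_one_pow_sq R j
  rw [hsquare, h.hankelDet_shift_two hn]
  rcases j with _ | m
  · -- for `j = 0` the product on the right vanishes and both squares are `1`
    have := hshift n
    rw [zero_add, h.hankelDet_one_eq_zero hn, mul_zero,
      show n + n + 1 = 0 + 2 * n + 1 by omega] at this
    rw [this]
    simp [hankelDet_zero]
  · have h1 := h.hankelDet_shift_two hn m
    have h2 := hankelDet_condensation Φ 0 m
    rw [show m + 1 + 2 * n + 1 = m + 2 * n + 2 by omega, h1]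
    simp only [zero_add] at h2
    linear_combination h2

/-- The **Gale–Robinson recurrence** at all shifts up to `n + 1`. The shift relation carries it
from each shift to the next. -/
theorem hankelDet_recurrence [IsDomain R] (h : IsMetallicRoot n Φ) (hn : 1 ≤ n) {s : ℕ}
    (hs : s ≤ n + 1) (j : ℕ) :
    hankelDet Φ s (j + 2 * n + 2) * hankelDet Φ s j =
      hankelDet Φ s (j + 2 * n + 1) * hankelDet Φ s (j + 1) - hankelDet Φ s (j + n + 1) ^ 2 := by
  induction s generalizing j with
  | zero => exact h.hankelDet_recurrence_zero hn j
  | succ s ih =>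
    obtain ⟨ε, hε, hshift⟩ := h.exists_sign_hankelDet_shift hn (show s ≤ n by omega)
    have hinv (k : ℕ) : hankelDet Φ (s + 1) k = ε * (-1) ^ k * hankelDet Φ s (k + n + 1) := by
      rw [hshift]
      linear_combination -hankelDet Φ (s + 1) k * (((-1) ^ k) ^ 2 * hε + neg_one_pow_sq R k)
    have hmul {k l : ℕ} (hkl : Even (k + l)) (x y : R) :
        ε * (-1) ^ k * x * (ε * (-1) ^ l * y) = x * y := by
      have := hkl.neg_one_pow (α := R)
      rw [pow_add] at this
      linear_combination x * y * (hε + ε ^ 2 * this)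
    have := ih (by omega) (j + n + 1)
    simp only [sq] at this
    simp only [hinv, sq]
    rw [hmul ⟨j + n + 1, by ring⟩, hmul ⟨j + n + 1, by ring⟩, hmul ⟨j + n + 1, by ring⟩]
    rw [show j + 2 * n + 2 + n + 1 = j + n + 1 + 2 * n + 2 by omega,
      show j + 2 * n + 1 + n + 1 = j + n + 1 + 2 * n + 1 by omega,
      show j + 1 + n + 1 = j + n + 1 + 1 by omega, this]

end IsMetallicRoot

/-! ### Convergence of the continued fraction -/

theorem qInt_one {R : Type*} [Semiring R] (x : R) : qInt 1 x = 1 := by simp [qInt]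

theorem qVar_ne_zero : qVar ≠ 0 := HahnSeries.single_ne_zero one_ne_zero

theorem pow_mul_qInt_inv {K : Type*} [Field K] {x : K} (hx : x ≠ 0) (n : ℕ) :
    x ^ n * qInt n x⁻¹ = x * qInt n x := by
  induction n with
  | zero => simp [qInt]
  | succ n ih =>
    have h1 : x ^ n * x⁻¹ ^ n = 1 := by rw [← mul_pow, mul_inv_cancel₀ hx, one_pow]
    have h2 := qInt_add 1 n x
    rw [qInt_one, add_comm 1 n, pow_one] at h2
    rw [h2, qInt_add n 1 x⁻¹, qInt_one]
    linear_combination x * ih + x * h1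

theorem map_qInt {R S : Type*} [Semiring R] [Semiring S] (f : R →+* S) (n : ℕ) (x : R) :
    f (qInt n x) = qInt n (f x) := by
  simp [qInt]

/-- If `B` is the coefficient of `Φ` in the quadratic equation and `C` is the Catalan series, then
`Φ = C(-X / B ^ 2) / B` is a root. -/
theorem exists_isMetallicRoot (n : ℕ) (hn : 1 ≤ n) : ∃ Φ : ℤ⟦X⟧, IsMetallicRoot n Φ := by
  set B : ℤ⟦X⟧ := (1 - PowerSeries.X) * (1 + PowerSeries.X ^ n)
    - PowerSeries.X * qInt n PowerSeries.X with hB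
  obtain ⟨D, hD⟩ := exists_mul_eq_one B (by simp [hB, show n ≠ 0 by omega])
  let C : ℤ⟦X⟧ := PowerSeries.map (Nat.castRingHom ℤ) PowerSeries.catalanSeries
  have hC : C ^ 2 * PowerSeries.X + 1 = C := by
    have := congrArg (PowerSeries.map (Nat.castRingHom ℤ))
      PowerSeries.catalanSeries_sq_mul_X_add_one
    simpa [C] using this
  let y : ℤ⟦X⟧ := -PowerSeries.X * D ^ 2
  have hy : PowerSeries.HasSubst y :=
    PowerSeries.HasSubst.of_constantCoeff_zero' (by simp [y])
  have hG := congrArg (PowerSeries.substAlgHom (R := ℤ) hy) hC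
  simp only [map_add, map_mul, map_pow, map_one, PowerSeries.substAlgHom_X] at hG
  set G := PowerSeries.substAlgHom (R := ℤ) hy C
  refine ⟨D * G, ?_⟩
  change PowerSeries.X * (D * G) ^ 2 + B * (D * G) = 1
  simp only [y] at hG
  linear_combination G * hD - hG

/-- Two steps of the continued fraction act on the continuants by a constant matrix, as the partial
numerators and denominators are `2`-periodic. -/
theorem qMetallicContFract_contsAux (n k : ℕ) :
    ((qMetallicContFract n).contsAux (k + 2)).a * qVar ^ n =
        (qVar * qInt n qVar ^ 2 + qVar ^ (2 * n)) * ((qMetallicContFract n).contsAux k).a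
          + qInt n qVar * ((qMetallicContFract n).contsAux k).b ∧
      ((qMetallicContFract n).contsAux (k + 2)).b * qVar ^ n =
        qVar * qInt n qVar * ((qMetallicContFract n).contsAux k).a
          + ((qMetallicContFract n).contsAux k).b := by
  set g := qMetallicContFract n
  have hs (k : ℕ) : g.s.get? k = some (if Even k then ⟨qVar ^ n, qInt n qVar⁻¹⟩
      else ⟨(qVar ^ n)⁻¹, qInt n qVar⟩) := rfl
  have heven {k : ℕ} (hk : Even k) : g.contsAux (k + 2)
      = ⟨qInt n qVar⁻¹ * (g.contsAux (k + 1)).a + qVar ^ n * (g.contsAux k).a,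
        qInt n qVar⁻¹ * (g.contsAux (k + 1)).b + qVar ^ n * (g.contsAux k).b⟩ :=
    GenContFract.contsAux_recurrence (gp := ⟨qVar ^ n, qInt n qVar⁻¹⟩)
      (by rw [hs, if_pos hk]) rfl rfl
  have hodd {k : ℕ} (hk : ¬ Even k) : g.contsAux (k + 2)
      = ⟨qInt n qVar * (g.contsAux (k + 1)).a + (qVar ^ n)⁻¹ * (g.contsAux k).a,
        qInt n qVar * (g.contsAux (k + 1)).b + (qVar ^ n)⁻¹ * (g.contsAux k).b⟩ :=
    GenContFract.contsAux_recurrence (gp := ⟨(qVar ^ n)⁻¹, qInt n qVar⟩)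
      (by rw [hs, if_neg hk]) rfl rfl
  have hinv := pow_mul_qInt_inv qVar_ne_zero n
  have hq : (qVar ^ n)⁻¹ * qVar ^ n = 1 := inv_mul_cancel₀ (pow_ne_zero n qVar_ne_zero)
  have h0 : g.contsAux 0 = ⟨1, 0⟩ := rfl
  have h1 : g.contsAux 1 = ⟨qInt n qVar, 1⟩ := rfl
  induction k using Nat.twoStepInduction with
  | zero =>
    rw [heven Even.zero, h0, zero_add, h1]
    constructor
    · linear_combination qInt n qVar * hinv
    · linear_combination hinv
  | one =>
    rw [hodd (by decide), heven Even.zero, h0, zero_add, h1]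
    constructor
    · linear_combination qInt n qVar ^ 2 * hinv + qInt n qVar * hq
    · linear_combination qInt n qVar * hinv + hq
  | more k ih1 ih2 =>
    -- the recurrences producing the continuants `k + 2` and `k + 4` have the same coefficients
    have hlin : ∃ b a : ℚ⸨X⸩, ∀ i ∈ ({k, k + 2} : Set ℕ), g.contsAux (i + 2)
        = ⟨b * (g.contsAux (i + 1)).a + a * (g.contsAux i).a,
          b * (g.contsAux (i + 1)).b + a * (g.contsAux i).b⟩ := by
      by_cases hk : Even k
      · refine ⟨qInt n qVar⁻¹, qVar ^ n, ?_⟩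
        rintro i (rfl | rfl)
        · exact heven hk
        · exact heven (hk.add even_two)
      · refine ⟨qInt n qVar, (qVar ^ n)⁻¹, ?_⟩
        rintro i (rfl | rfl)
        · exact hodd hk
        · exact hodd (by simpa [Nat.even_add] using hk)
    obtain ⟨b, a, hlin⟩ := hlin
    rw [hlin (k + 2) (by simp)]
    have h := hlin k (by simp)
    have ha := congrArg GenContFract.Pair.a h
    have hb := congrArg GenContFract.Pair.b h
    constructor
    · linear_combination b * ih2.1 + a * ih1.1
        - (qVar * qInt n qVar ^ 2 + qVar ^ (2 * n)) * ha - qInt n qVar * hb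
    · linear_combination b * ih2.2 + a * ih1.2 - qVar * qInt n qVar * ha - hb

/-- Each convergent is a power series, and two further steps of the continued fraction improve the
approximation of `Φ` by a factor `q ^ (2 * n)`. -/
theorem exists_powerSeries_qMetallicContFract_conts {n : ℕ} (hn : 1 ≤ n) {Φ : ℚ⟦X⟧}
    (hΦ : IsMetallicRoot n Φ) (k : ℕ) :
    ∃ u : ℚ⟦X⟧, ((qMetallicContFract n).contsAux (k + 1)).b ≠ 0 ∧
      ((qMetallicContFract n).contsAux (k + 1)).a
        = (u : ℚ⸨X⸩) * ((qMetallicContFract n).contsAux (k + 1)).b ∧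
      PowerSeries.X ^ (k / 2) ∣ u - Φ := by
  have hX : ((PowerSeries.X : ℚ⟦X⟧) : ℚ⸨X⸩) = qVar := PowerSeries.coe_X
  have hcoe : ((qInt n PowerSeries.X : ℚ⟦X⟧) : ℚ⸨X⸩) = qInt n qVar := by
    rw [← hX, map_qInt]
  set N : ℚ⟦X⟧ := qInt n PowerSeries.X with hN
  have hNinv : N * N⁻¹ = 1 := PowerSeries.mul_inv_cancel _ (by
    rw [← PowerSeries.coeff_zero_eq_constantCoeff_apply, coeff_qInt_X, if_pos (by omega)]
    exact one_ne_zero)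
  have hqn : qVar ^ n ≠ 0 := pow_ne_zero n qVar_ne_zero
  have hN0 : qInt n qVar ≠ 0 := by
    rw [← hcoe]
    exact (map_ne_zero_iff _ HahnSeries.ofPowerSeries_injective).mpr
      (left_ne_zero_of_mul_eq_one hNinv)
  induction k using Nat.twoStepInduction with
  | zero =>
    refine ⟨N, ?_, ?_, by simp⟩
    · exact one_ne_zero
    · change qInt n qVar = _ * 1
      rw [hcoe, mul_one]
  | one =>
    have hinv := pow_mul_qInt_inv qVar_ne_zero n
    have h := qMetallicContFract_contsAux n 0
    rw [show (qMetallicContFract n).contsAux 0 = ⟨1, 0⟩ from rfl] at h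
    simp only [mul_one, mul_zero, add_zero, zero_add] at h
    have hb : ((qMetallicContFract n).contsAux (1 + 1)).b ≠ 0 := by
      refine left_ne_zero_of_mul (b := qVar ^ n) ?_
      rw [h.2]
      exact mul_ne_zero qVar_ne_zero hN0
    refine ⟨N + PowerSeries.X ^ (2 * n - 1) * N⁻¹, hb, ?_, by simp⟩
    refine mul_right_cancel₀ hqn ?_
    rw [mul_assoc, h.1, h.2]
    have hcN := congrArg (fun x : ℚ⟦X⟧ => (x : ℚ⸨X⸩)) hNinv
    simp only [map_mul, map_one, hcoe] at hcN
    have hpow : qVar ^ (2 * n) = qVar ^ (2 * n - 1) * qVar := by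
      rw [← pow_succ]
      congr 1
      omega
    rw [map_add, map_mul, map_pow, hX, hcoe, hpow]
    linear_combination -qVar ^ (2 * n - 1) * qVar * hcN
  | more k ih _ =>
    obtain ⟨u, hb, ha, hdvd⟩ := ih
    set D : ℚ⟦X⟧ := 1 + PowerSeries.X * N * u with hD
    have hDinv : D * D⁻¹ = 1 := PowerSeries.mul_inv_cancel _ (by simp [hD])
    have hcD : ((D : ℚ⟦X⟧) : ℚ⸨X⸩) = 1 + qVar * qInt n qVar * u := by
      rw [hD, map_add, map_mul, map_mul, hX, hcoe, map_one]
    have hcDinv := congrArg (fun x : ℚ⟦X⟧ => (x : ℚ⸨X⸩)) hDinv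
    simp only [map_mul, map_one] at hcDinv
    have h := qMetallicContFract_contsAux n (k + 1)
    have h2 : ((qMetallicContFract n).contsAux (k + 1 + 2)).b * qVar ^ n
        = (D : ℚ⸨X⸩) * ((qMetallicContFract n).contsAux (k + 1)).b := by
      rw [h.2, ha, hcD]
      ring
    refine ⟨N + PowerSeries.X ^ (2 * n) * u * D⁻¹, ?_, ?_, ?_⟩
    · refine left_ne_zero_of_mul (b := qVar ^ n) ?_
      rw [show k + 2 + 1 = k + 1 + 2 by ring, h2]
      exact mul_ne_zero (left_ne_zero_of_mul_eq_one hcDinv) hb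
    · refine mul_right_cancel₀ hqn ?_
      rw [show k + 2 + 1 = k + 1 + 2 by ring, mul_assoc, h2, h.1, ha]
      rw [map_add, map_mul, map_mul, map_pow, hX, hcoe]
      linear_combination -qVar ^ (2 * n) * u * ((qMetallicContFract n).contsAux (k + 1)).b * hcDinv
        - qInt n qVar * ((qMetallicContFract n).contsAux (k + 1)).b * hcD
    · set E : ℚ⟦X⟧ := 1 + PowerSeries.X * N * Φ with hE
      have hEinv : E * E⁻¹ = 1 := PowerSeries.mul_inv_cancel _ (by simp [hE])
      -- the fixed point equation of the map `u ↦ N + X ^ (2 * n) * u / (1 + X * N * u)`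
      have hfix : Φ = N + PowerSeries.X ^ (2 * n) * Φ * E⁻¹ := by
        have h1 := one_sub_mul_qInt n (PowerSeries.X : ℚ⟦X⟧)
        have h3 : Φ * E = N * E + PowerSeries.X ^ (2 * n) * Φ := by
          unfold IsMetallicRoot at hΦ
          rw [hE]
          linear_combination N * hΦ - (1 + PowerSeries.X ^ n) * Φ * h1
        linear_combination E⁻¹ * h3 + (N - Φ) * hEinv
      have hdiff : N + PowerSeries.X ^ (2 * n) * u * D⁻¹ - Φ
          = PowerSeries.X ^ (2 * n) * (u - Φ) * (D⁻¹ * E⁻¹) := by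
        linear_combination -hfix + PowerSeries.X ^ (2 * n) * Φ * E⁻¹ * hDinv
          - PowerSeries.X ^ (2 * n) * u * D⁻¹ * hEinv
      rw [hdiff]
      refine Dvd.dvd.mul_right ?_ _
      refine (pow_dvd_pow _ (show (k + 2) / 2 ≤ 2 * n + k / 2 by omega)).trans ?_
      rw [pow_add]
      exact mul_dvd_mul_left _ hdvd

theorem tendsto_coe_of_X_pow_dvd_sub {K : Type*} [Field K] {u : ℕ → K⟦X⟧} {Φ : K⟦X⟧} {e : ℕ → ℕ}
    (he : Filter.Tendsto e Filter.atTop Filter.atTop)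
    (h : ∀ k, PowerSeries.X ^ e k ∣ u k - Φ) :
    Filter.Tendsto (fun k => ((u k : K⟦X⟧) : K⸨X⸩)) Filter.atTop (nhds (Φ : K⸨X⸩)) := by
  rw [Filter.tendsto_def]
  intro s hs
  rw [Valued.mem_nhds] at hs
  obtain ⟨γ, hγ⟩ := hs
  have hγ0 : MonoidWithZeroHom.ValueGroup₀.embedding γ.1 ≠ 0 := by simp
  filter_upwards [he.eventually_gt_atTop
    (-WithZero.log (MonoidWithZeroHom.ValueGroup₀.embedding γ.1)).toNat] with k hk
  refine hγ ?_
  rw [Set.mem_ofPred_eq, Valuation.restrict_lt_iff_lt_embedding, ← map_sub]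
  refine lt_of_le_of_lt (b := WithZero.exp (-(e k : ℤ))) ?_ ?_
  · obtain ⟨w, hw⟩ := h k
    rw [hw, map_mul, map_mul, map_pow, LaurentSeries.valuation_X_pow]
    refine mul_le_of_le_one_right' ?_
    rw [LaurentSeries.val_le_one_iff_eq_coe]
    exact ⟨w, rfl⟩
  · rw [← WithZero.lt_log_iff_exp_lt hγ0]
    omega

theorem isQMetallic_of_isMetallicRoot {n : ℕ} (hn : 1 ≤ n) {Φ : ℤ⟦X⟧} (h : IsMetallicRoot n Φ) :
    IsQMetallic n Φ := by
  have hQ : IsMetallicRoot n (PowerSeries.map (Int.castRingHom ℚ) Φ) := by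
    have := congrArg (PowerSeries.map (Int.castRingHom ℚ)) h
    simpa [IsMetallicRoot, map_qInt] using this
  choose u hb ha hdvd using exists_powerSeries_qMetallicContFract_conts hn hQ
  have hconv : (qMetallicContFract n).convs = fun k => ((u k : ℚ⟦X⟧) : ℚ⸨X⸩) := by
    funext k
    rw [GenContFract.conv_eq_conts_a_div_conts_b]
    exact (div_eq_iff (hb k)).mpr (ha k)
  unfold IsQMetallic
  rw [hconv]
  exact tendsto_coe_of_X_pow_dvd_sub (Nat.tendsto_div_const_atTop two_ne_zero) hdvd

theorem IsQMetallic.unique {n : ℕ} {Φ Ψ : ℤ⟦X⟧} (hΦ : IsQMetallic n Φ) (hΨ : IsQMetallic n Ψ) :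
    Φ = Ψ :=
  PowerSeries.map_injective _ (RingHom.injective_int _)
    (HahnSeries.ofPowerSeries_injective (tendsto_nhds_unique hΦ hΨ))

theorem mainTheorem3 (n : ℕ) (hn : 1 ≤ n) :
    (∃! Φ : ℤ⟦X⟧, IsQMetallic n Φ) ∧
    ∀ Φ : ℤ⟦X⟧, IsQMetallic n Φ → ∀ ℓ : ℕ, ℓ ≤ n + 1 → ∀ j : ℕ,
      hankelDet Φ ℓ (j + 2 * n + 2) * hankelDet Φ ℓ j =
        hankelDet Φ ℓ (j + 2 * n + 1) * hankelDet Φ ℓ (j + 1)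
          - hankelDet Φ ℓ (j + n + 1) ^ 2 := by
  obtain ⟨Ψ, hΨ⟩ := exists_isMetallicRoot n hn
  have hlim := isQMetallic_of_isMetallicRoot hn hΨ
  refine ⟨⟨Ψ, hlim, fun Φ hΦ => hΦ.unique hlim⟩, fun Φ hΦ ℓ hℓ j => ?_⟩
  rw [hΦ.unique hlim]
  exact hΨ.hankelDet_recurrence hn hℓ j
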